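/- Let $d,L\in\{1,2,\dots\}$, let $K\subset\mathbb R^d$ be nonempty and compact, and let $C(K)$ be the space of continuous real functions on $K$ with the maximum norm. Let $w_0:=d$, $w_{L+1}:=1$, let $w_1,\dots,w_L$ be positive integers, and let $\sigma_1,\dots,\sigma_L:\mathbb R\to\mathbb R$ be continuous and not polynomials. For $\alpha=\{(A_i,b_i)\}_{i=1}^{L+1}$ with $A_i\in\mathbb R^{w_i\times w_{i-1}}$, $b_i\in\mathbb R^{w_i}$, put $\varphi_i(z):=\sigma_i(A_iz+b_i)$ for $i\le L$ ($\sigma_i$ acting componentwise), $\varphi_{L+1}(z):=A_{L+1}z+b_{L+1}$ and $\psi(\alpha,x):=(\varphi_{L+1}\circ\dots\circ\varphi_1)(x)$, $x\in\mathbb R^d$. Let $D$ be the space of all such $\alpha$, with the Euclidean norm of $\mathbb R^m$, $m:=\sum_{i=1}^{L+1}w_i(w_{i-1}+1)$, and let $\Psi:D\to C(K)$, $\Psi(\alpha):=\psi(\alpha,\cdot)|_K$. For $a\in\mathbb R^d$, $c\in\mathbb R$ let $z_{a,c}\in C(K)$, $z_{a,c}(x):=a^\top x+c$. Let $y_T\in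 C(K)$ and $\mathcal L:C(K)\times C(K)\to\mathbb R$. Assume: 1. $w_i\ge 2$ for all $i=1,\dots,L$. 2. For every $i=1,\dots,L$, $\sigma_i$ is affine and nonconstant on some nonempty open interval $I_i$. 3. $y_T$ is nonaffine, i.e. $y_T\ne z_{a,c}$ for all $(a,c)\in\mathbb R^d\times\mathbb R$. 4. For every $v\in C(K)$ with $v\neq y_T$, $\mathcal L$ is Gâteaux differentiable in its first argument at $(v,y_T)$ with nonzero derivative, i.e. there is a nonzero continuous linear functional $p$ on $C(K)$ with $\lim_{s\to0^+}\frac{\mathcal L(v+sh,y_T)-\mathcal L(v,y_T)}{s}=p(h)$ for all $h\in C(K)$. 5. There is $(\bar a,\bar c)\in\mathbb R^d\times\mathbb R$ with $\mathcal L(z_{\bar a,\bar c},y_T)\le\mathcal L(z_{a,c},y_T)$ for all $(a,c)\in\mathbb R^d\times\mathbb R$. Then there is a set $E\subset D$ of Hausdorff dimension $\dim_{\mathcal H}(E)\ge m-d-1$ such that every $\alpha\in E$ is a spurious local minimum (a local minimum that is not a global minimum) of the problem of minimizing $\mathcal L(\Psi(\alpha),y_T)$ over $\alpha\in D$, and $$\mathcal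 L(\Psi(\alpha),y_T)=\min_{(a,c)\in\mathbb R^d\times\mathbb R}\mathcal L(z_{a,c},y_T)\qquad\text{for all }\alpha\in E.$$ -/

import Mathlib

open Filter Topology Matrix
open scoped ENNReal

/-! ### Fully connected feedforward networks

`L` is the number of hidden layers and `w : Fin (L + 1) → ℕ` lists the widths
`w 0 = d` (input dimension), `w 1, …, w L` (hidden layers); the output layer has width `1`.
The activation of the `(i + 1)`-st layer, of width `w i.succ`, is `σ i` for `i : Fin L`. -/

/-- Index set of the scalar parameters. Hidden layer: a row `j`, together with either a column `k`
(the weight entry `A j k`) or the extra point (the bias entry `b j`). Output layer: a column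
(the entry of the one-row weight matrix) or the extra point (the scalar bias). -/
abbrev ParamIndex {L : ℕ} (w : Fin (L + 1) → ℕ) : Type :=
  (Σ i : Fin L, Fin (w i.succ) × (Fin (w i.castSucc) ⊕ Unit)) ⊕ (Fin (w (Fin.last L)) ⊕ Unit)

/-- The parameter space `D`, with the Euclidean norm of the vector of all parameters. -/
abbrev ParamSpace {L : ℕ} (w : Fin (L + 1) → ℕ) : Type :=
  EuclideanSpace ℝ (ParamIndex w)

/-- The number `m = w_{L+1} (w_L + 1) + ⋯ + w_1 (w_0 + 1)` of parameters, where `w_{L+1} = 1`. -/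
def numParams {L : ℕ} (w : Fin (L + 1) → ℕ) : ℕ :=
  (∑ i : Fin L, w i.succ * (w i.castSucc + 1)) + (w (Fin.last L) + 1)

theorem finrank_paramSpace {L : ℕ} (w : Fin (L + 1) → ℕ) :
    Module.finrank ℝ (ParamSpace w) = numParams w := by
  simp [numParams, Fintype.card_sigma]

namespace ParamSpace

variable {L : ℕ} {w : Fin (L + 1) → ℕ}

/-- Weight matrix of a hidden layer. -/
def weight (α : ParamSpace w) (i : Fin L) : Matrix (Fin (w i.succ)) (Fin (w i.castSucc)) ℝ :=
  Matrix.of fun j k => α (Sum.inl ⟨i, j, Sum.inl k⟩)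

/-- Bias vector of a hidden layer. -/
def bias (α : ParamSpace w) (i : Fin L) : Fin (w i.succ) → ℝ :=
  fun j => α (Sum.inl ⟨i, j, Sum.inr ()⟩)

/-- The single row of the weight matrix of the output layer. -/
def outWeight (α : ParamSpace w) : Fin (w (Fin.last L)) → ℝ :=
  fun k => α (Sum.inr (Sum.inl k))

/-- Bias of the output layer. -/
def outBias (α : ParamSpace w) : ℝ :=
  α (Sum.inr (Sum.inr ()))

end ParamSpace

/-- Output of the first `i` layers of the network at the input `x`:
`z_0 = x` and `z_{i+1} = σ (A z_i + b)`, with `σ` acting componentwise. -/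
def layerOutput {L : ℕ} {w : Fin (L + 1) → ℕ} (σ : Fin L → C(ℝ, ℝ)) (α : ParamSpace w)
    (x : EuclideanSpace ℝ (Fin (w 0))) (i : Fin (L + 1)) : Fin (w i) → ℝ :=
  Fin.induction (motive := fun i => Fin (w i) → ℝ) (fun j => x j)
    (fun i z j => σ i ((α.weight i *ᵥ z + α.bias i) j)) i

/-- The network function `ψ(α, x)`. -/
def network {L : ℕ} {w : Fin (L + 1) → ℕ} (σ : Fin L → C(ℝ, ℝ)) (α : ParamSpace w)
    (x : EuclideanSpace ℝ (Fin (w 0))) : ℝ :=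
  α.outWeight ⬝ᵥ layerOutput σ α x (Fin.last L) + α.outBias

theorem continuous_layerOutput {L : ℕ} {w : Fin (L + 1) → ℕ} (σ : Fin L → C(ℝ, ℝ))
    (α : ParamSpace w) (i : Fin (L + 1)) : Continuous fun x => layerOutput σ α x i := by
  induction i using Fin.induction with
  | zero => simp only [layerOutput, Fin.induction_zero]; fun_prop
  | succ i ih =>
    simp only [layerOutput, Fin.induction_succ] at ih ⊢
    refine continuous_pi fun j => (σ i).continuous.comp ?_
    simp only [Pi.add_apply]
    exact ((continuous_apply j).comp (continuous_const.matrix_mulVec ih)).add continuous_const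

theorem continuous_network {L : ℕ} {w : Fin (L + 1) → ℕ} (σ : Fin L → C(ℝ, ℝ))
    (α : ParamSpace w) : Continuous (network σ α) := by
  unfold network
  exact (continuous_const.dotProduct (continuous_layerOutput σ α _)).add continuous_const

/-- The operator `Ψ : D → C(K)`, `Ψ(α) = ψ(α, ·)|_K`. -/
def realization {L : ℕ} {w : Fin (L + 1) → ℕ} (σ : Fin L → C(ℝ, ℝ))
    (K : Set (EuclideanSpace ℝ (Fin (w 0)))) (α : ParamSpace w) : C(K, ℝ) where
  toFun x := network σ α x
  continuous_toFun := (continuous_network σ α).comp continuous_subtype_val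

/-- The affine function `z_{a,c}(x) = aᵀ x + c` on `K`. -/
noncomputable def affineFun {d : ℕ} (K : Set (EuclideanSpace ℝ (Fin d))) (a : EuclideanSpace ℝ (Fin d))
    (c : ℝ) : C(K, ℝ) where
  toFun x := inner ℝ a (x : EuclideanSpace ℝ (Fin d)) + c
  continuous_toFun := by fun_prop

/-- `f` is Gâteaux differentiable at `v` with derivative `f'`: the one-sided directional
derivative exists in every direction `h` and equals `f' h`, with `f'` linear and continuous. For
`E = C(K, ℝ)` with `K` compact, the topology on `E` is that of the maximum norm. -/
def HasGateauxDerivAt {E : Type*} [AddCommGroup E] [Module ℝ E] [TopologicalSpace E]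
    (f : E → ℝ) (f' : E →L[ℝ] ℝ) (v : E) : Prop :=
  ∀ h : E, Tendsto (fun s : ℝ => (f (v + s • h) - f v) / s) (𝓝[>] 0) (𝓝 (f' h))

/-- A local minimum that is not a global minimum. -/
def IsSpuriousLocalMin {X : Type*} [TopologicalSpace X] (f : X → ℝ) (x : X) : Prop :=
  IsLocalMin f x ∧ ¬ ∀ y, f x ≤ f y

open scoped ContDiff in
theorem exists_polynomial_of_iteratedDeriv_eq_zero (k : ℕ) :
    ∀ g : ℝ → ℝ, ContDiff ℝ ∞ g → (∀ x, iteratedDeriv k g x = 0) →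
      ∃ P : Polynomial ℝ, P ∈ Polynomial.degreeLT ℝ k ∧ ∀ x, g x = P.eval x := by
  induction k with
  | zero =>
    intro g _ h
    exact ⟨0, Submodule.zero_mem _, by simpa using h⟩
  | succ k ih =>
    intro g hg h
    have hdiff : Differentiable ℝ g := hg.differentiable (by simp)
    obtain ⟨P, hP, hPg⟩ := ih (deriv g) (contDiff_infty_iff_deriv.1 hg).2
      (by simpa only [iteratedDeriv_succ'] using h)
    set Q : Polynomial ℝ := ∑ i ∈ Finset.range k, Polynomial.monomial (i + 1) (P.coeff i / (i + 1))
      with hQ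
    have hQP : Polynomial.derivative Q = P := by
      ext n
      rw [Polynomial.coeff_derivative, hQ, Polynomial.finsetSum_coeff]
      simp only [Polynomial.coeff_monomial, Nat.add_right_cancel_iff, Finset.sum_ite_eq',
        Finset.mem_range]
      split_ifs with hn
      · have : (n : ℝ) + 1 ≠ 0 := by positivity
        field_simp
      · rw [zero_mul, Polynomial.coeff_eq_zero_of_degree_lt]
        exact (Polynomial.mem_degreeLT.1 hP).trans_le (by exact_mod_cast not_lt.1 hn)
    refine ⟨Q + Polynomial.C (g 0 - Q.eval 0), Submodule.add_mem _ ?_ ?_, fun x => ?_⟩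
    · refine Submodule.sum_mem _ fun i hi => Polynomial.mem_degreeLT.2 ?_
      refine (Polynomial.degree_monomial_le _ _).trans_lt ?_
      exact_mod_cast Nat.succ_lt_succ (Finset.mem_range.1 hi)
    · exact Polynomial.mem_degreeLT.2 (Polynomial.degree_C_le.trans_lt (by positivity))
    · have := is_const_of_deriv_eq_zero (f := fun x => g x - Q.eval x)
        (hdiff.sub Q.differentiable) (fun x => by
          rw [deriv_fun_sub (hdiff x) Q.differentiableAt, Polynomial.deriv, hQP, hPg, sub_self]) x 0
      simp only [Polynomial.eval_add, Polynomial.eval_C]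
      linarith

/-- A pointwise limit of polynomials of bounded degree is a polynomial. -/
theorem exists_polynomial_of_tendsto {ι : Type*} {l : Filter ι} [l.NeBot] (k : ℕ)
    {P : ι → Polynomial ℝ} (hP : ∀ i, P i ∈ Polynomial.degreeLT ℝ k) {f : ℝ → ℝ}
    (h : ∀ x, Tendsto (fun i => (P i).eval x) l (𝓝 (f x))) :
    ∃ Q : Polynomial ℝ, ∀ x, f x = Q.eval x := by
  have hinj : Set.InjOn (fun i : ℕ => (i : ℝ)) (Finset.range k) :=
    Nat.cast_injective.injOn
  refine ⟨Lagrange.interpolate (Finset.range k) (fun i : ℕ => (i : ℝ)) fun i => f i, fun x => ?_⟩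
  refine tendsto_nhds_unique (h x) ?_
  have heq : ∀ i, (P i).eval x = ∑ j ∈ Finset.range k,
      (P i).eval (j : ℝ) * (Lagrange.basis (Finset.range k) (fun i : ℕ => (i : ℝ)) j).eval x := by
    intro i
    conv_lhs => rw [Lagrange.eq_interpolate (f := P i) hinj
      (by simpa using Polynomial.mem_degreeLT.1 (hP i))]
    simp [Lagrange.interpolate_apply, Polynomial.eval_finsetSum]
  simp only [Lagrange.interpolate_apply, Polynomial.eval_finsetSum, Polynomial.eval_mul,
    Polynomial.eval_C, heq]
  exact tendsto_finsetSum _ fun j _ => (h _).mul_const _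

section Density

variable {X : Type*} [TopologicalSpace X]

/-- The map `x ↦ u x ^ k * g (t * u x + b)`. -/
def powMulComp (u : C(X, ℝ)) (g : C(ℝ, ℝ)) (k : ℕ) (b t : ℝ) : C(X, ℝ) :=
  u ^ k * g.comp (t • u + ContinuousMap.const X b)

theorem powMulComp_apply (u : C(X, ℝ)) (g : C(ℝ, ℝ)) (k : ℕ) (b t : ℝ) (x : X) :
    powMulComp u g k b t x = u x ^ k * g (t * u x + b) := rfl

theorem continuous_powMulComp (u : C(X, ℝ)) (g : C(ℝ, ℝ)) (k : ℕ) (b : ℝ) :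
    Continuous (powMulComp u g k b) := by
  refine ContinuousMap.continuous_of_continuous_uncurry _ ?_
  simp only [Function.uncurry_def, powMulComp_apply]
  fun_prop

variable [CompactSpace X]

/-- A curve in `C(X, ℝ)` is differentiable if it is pointwise differentiable with a derivative that
is continuous as a curve in `C(X, ℝ)`. -/
theorem ContinuousMap.hasDerivAt_of_forall_apply {F F' : ℝ → C(X, ℝ)} (hF' : Continuous F')
    (h : ∀ x t, HasDerivAt (fun t => F t x) (F' t x) t) (t : ℝ) : HasDerivAt F (F' t) t := by
  have hFeq : F = fun t => F 0 + ∫ s in (0 : ℝ)..t, F' s := by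
    funext t
    ext x
    have h1 : (∫ s in (0 : ℝ)..t, F' s) x = ∫ s in (0 : ℝ)..t, F' s x :=
      ((ContinuousMap.evalCLM ℝ x).intervalIntegral_comp_comm
        (hF'.intervalIntegrable 0 t)).symm
    have h2 : ∫ s in (0 : ℝ)..t, F' s x = F t x - F 0 x :=
      intervalIntegral.integral_eq_sub_of_hasDerivAt (fun s _ => h x s)
        (((ContinuousMap.evalCLM ℝ x).continuous.comp hF').intervalIntegrable 0 t)
    rw [ContinuousMap.add_apply, h1, h2]
    ring
  rw [hFeq]
  exact (intervalIntegral.integral_hasDerivAt_right (hF'.intervalIntegrable 0 t)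
    (hF'.stronglyMeasurableAtFilter _ _) hF'.continuousAt).const_add _

open scoped ContDiff in
/-- If a functional kills all `g (t u + b)` then it kills all `u ^ k` for which the `k`-th
derivative of `g` does not vanish identically. -/
theorem map_pow_eq_zero_of_contDiff (p : C(X, ℝ) →L[ℝ] ℝ) (u : C(X, ℝ)) {g : ℝ → ℝ}
    (hg : ContDiff ℝ ∞ g)
    (hp : ∀ b t : ℝ, p ((⟨g, hg.continuous⟩ : C(ℝ, ℝ)).comp (t • u + ContinuousMap.const X b)) = 0)
    (k : ℕ) {b : ℝ} (hk : iteratedDeriv k g b ≠ 0) : p (u ^ k) = 0 := by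
  have hc : ∀ k, Continuous (iteratedDeriv k g) := fun k =>
    hg.continuous_iteratedDeriv k (by exact_mod_cast le_top)
  have key : ∀ k t, p (powMulComp u ⟨iteratedDeriv k g, hc k⟩ k b t) = 0 := by
    intro k
    induction k with
    | zero =>
      intro t
      convert hp b t using 2
      ext x
      simp [powMulComp_apply]
    | succ k ih =>
      intro t
      have hd := ContinuousMap.hasDerivAt_of_forall_apply
        (F := powMulComp u ⟨iteratedDeriv k g, hc k⟩ k b)
        (continuous_powMulComp u ⟨iteratedDeriv (k + 1) g, hc (k + 1)⟩ (k + 1) b)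
        (fun x s => by
          simp only [powMulComp_apply, ContinuousMap.coe_mk]
          have h1 : HasDerivAt (iteratedDeriv k g) (iteratedDeriv (k + 1) g (s * u x + b))
              (s * u x + b) := by
            rw [iteratedDeriv_succ]
            exact ((hg.differentiable_iteratedDeriv k
              (by exact_mod_cast WithTop.coe_lt_top _)) _).hasDerivAt
          have h2 : HasDerivAt (fun s : ℝ => s * u x + b) (u x) s := by
            simpa using ((hasDerivAt_id s).mul_const (u x)).add_const b
          refine ((h1.comp s h2).const_mul (u x ^ k)).congr_deriv ?_
          ring) t
      have h1 := p.hasFDerivAt.comp_hasDerivAt t hd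
      have h2 : (p ∘ powMulComp u ⟨iteratedDeriv k g, hc k⟩ k b) = fun _ => 0 := funext ih
      rw [h2] at h1
      exact h1.unique (hasDerivAt_const t (0 : ℝ))
  have h0 := key k 0
  have h1 : powMulComp u ⟨iteratedDeriv k g, hc k⟩ k b 0 = iteratedDeriv k g b • u ^ k := by
    ext x
    simp [powMulComp_apply, mul_comm]
  rw [h1, map_smul, smul_eq_mul] at h0
  exact (mul_eq_zero.1 h0).resolve_left hk

open scoped Convolution in
open MeasureTheory in
/-- Functionals that kill all `σ (t u + b)` also kill all `(ρ ⋆ σ) (t u + b)`. -/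
theorem map_convolution_comp_eq_zero (p : C(X, ℝ) →L[ℝ] ℝ) (u : C(X, ℝ)) (σ : C(ℝ, ℝ))
    (hp : ∀ b t : ℝ, p (σ.comp (t • u + ContinuousMap.const X b)) = 0) {ρ : ℝ → ℝ}
    (hρ : Continuous ρ) (hρc : HasCompactSupport ρ)
    (hg : Continuous (ρ ⋆[ContinuousLinearMap.lsmul ℝ ℝ, volume] σ)) (b t : ℝ) :
    p ((⟨_, hg⟩ : C(ℝ, ℝ)).comp (t • u + ContinuousMap.const X b)) = 0 := by
  set F : ℝ → C(X, ℝ) := fun y => ρ y • σ.comp (t • u + ContinuousMap.const X (b - y)) with hF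
  have hFc : Continuous F := by
    refine ContinuousMap.continuous_of_continuous_uncurry _ ?_
    simp only [Function.uncurry_def, hF, ContinuousMap.smul_apply, ContinuousMap.comp_apply,
      ContinuousMap.add_apply, ContinuousMap.const_apply]
    fun_prop
  have hFi : Integrable F := hFc.integrable_of_hasCompactSupport hρc.smul_right
  have heq : (⟨_, hg⟩ : C(ℝ, ℝ)).comp (t • u + ContinuousMap.const X b) = ∫ y, F y := by
    ext x
    have h1 : (∫ y, F y) x = ∫ y, F y x :=
      ((ContinuousMap.evalCLM ℝ x).integral_comp_comm hFi).symm
    rw [h1]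
    simp [convolution_def, hF, add_sub_assoc]
  rw [heq, ← p.integral_comp_comm hFi]
  simp [hF, hp]

open scoped Convolution ContDiff in
open MeasureTheory in
theorem map_pow_eq_zero_of_not_polynomial (p : C(X, ℝ) →L[ℝ] ℝ) (σ : C(ℝ, ℝ))
    (hσ : ¬ ∃ P : Polynomial ℝ, ∀ s, σ s = P.eval s) (u : C(X, ℝ))
    (hp : ∀ b t : ℝ, p (σ.comp (t • u + ContinuousMap.const X b)) = 0) (k : ℕ) : p (u ^ k) = 0 := by
  by_contra hk
  let φ : ℕ → ContDiffBump (0 : ℝ) := fun n =>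
    ⟨1 / (n + 1 : ℝ) / 2, 1 / (n + 1 : ℝ), by positivity, half_lt_self (by positivity)⟩
  have hφ : Tendsto (fun n => (φ n).rOut) atTop (𝓝 0) := tendsto_one_div_add_atTop_nhds_zero_nat
  set g : ℕ → ℝ → ℝ := fun n =>
    ((φ n).normed volume) ⋆[ContinuousLinearMap.lsmul ℝ ℝ, volume] σ with hgdef
  have hg : ∀ n, ContDiff ℝ ∞ (g n) := fun n =>
    ((φ n).hasCompactSupport_normed).contDiff_convolution_left _ (φ n).contDiff_normed
      σ.continuous.locallyIntegrable
  have h0 : ∀ n b, iteratedDeriv k (g n) b = 0 := by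
    intro n b
    by_contra hb
    exact hk (map_pow_eq_zero_of_contDiff p u (hg n)
      (map_convolution_comp_eq_zero p u σ hp (φ n).continuous_normed
        (φ n).hasCompactSupport_normed (hg n).continuous) k hb)
  choose P hPk hP using fun n => exists_polynomial_of_iteratedDeriv_eq_zero k (g n) (hg n) (h0 n)
  refine hσ (exists_polynomial_of_tendsto (l := atTop) k hPk fun x => ?_)
  simp only [← hP]
  exact ContDiffBump.convolution_tendsto_right_of_continuous hφ σ.continuous x

/-- Density of ridge functions `σ (⟪a, x⟫ + b)` in `C(K)` for continuous nonpolynomial `σ`, in dual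
form. -/
theorem eq_zero_of_map_ridge_eq_zero {V : Type*} [NormedAddCommGroup V] [InnerProductSpace ℝ V]
    (K : Set V) [CompactSpace K] (σ : C(ℝ, ℝ))
    (hσ : ¬ ∃ P : Polynomial ℝ, ∀ s, σ s = P.eval s) (p : C(K, ℝ) →L[ℝ] ℝ)
    (ridge : V → ℝ → C(K, ℝ)) (hridge : ∀ a b x, ridge a b x = σ (b + inner ℝ a (x : V)))
    (hp : ∀ a b, p (ridge a b) = 0) : p = 0 := by
  let u : V → C(K, ℝ) := fun a => ⟨fun x => inner ℝ a (x : V), by fun_prop⟩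
  have hpow : ∀ a k, p (u a ^ k) = 0 := fun a k =>
    map_pow_eq_zero_of_not_polynomial p σ hσ (u a) (fun b t => by
      rw [← hp (t • a) b]
      congr 1
      ext x
      simp [hridge, u, real_inner_smul_left, add_comm]) k
  have hexp : ∀ a, p (NormedSpace.exp (u a)) = 0 := by
    intro a
    have h := (NormedSpace.exp_series_hasSum_exp' (𝕂 := ℝ) (u a)).mapL p
    simp only [map_smul, hpow, smul_zero] at h
    exact h.unique hasSum_zero
  have hmap : ∀ (f : C(K, ℝ)) x, NormedSpace.exp f x = Real.exp (f x) := by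
    intro f x
    rw [Real.exp_eq_exp_ℝ]
    exact NormedSpace.map_exp (ContinuousMap.evalAlgHom ℝ ℝ x)
      (ContinuousMap.evalCLM ℝ x : C(K, ℝ) →L[ℝ] ℝ).continuous f
  let S : Submonoid C(K, ℝ) :=
    { carrier := Set.range fun a => NormedSpace.exp (u a)
      one_mem' := ⟨0, by ext x; simp [hmap, u]⟩
      mul_mem' := by
        rintro _ _ ⟨a, rfl⟩ ⟨b, rfl⟩
        exact ⟨a + b, by ext x; simp [hmap, u, inner_add_left, Real.exp_add]⟩ }
  have hsep : (Algebra.adjoin ℝ (S : Set C(K, ℝ))).SeparatesPoints := by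
    intro x y hxy
    refine ⟨_, ⟨_, Algebra.subset_adjoin ⟨(x : V) - y, rfl⟩, rfl⟩, fun h => hxy ?_⟩
    have h' := Real.exp_injective (((hmap _ x).symm.trans h).trans (hmap _ y))
    have h0 : inner ℝ ((x : V) - y) ((x : V) - y) = 0 := by
      rw [inner_sub_right, sub_eq_zero]
      exact h'
    exact Subtype.ext (sub_eq_zero.1 (inner_self_eq_zero.1 h0))
  have hdense := ContinuousMap.subalgebra_topologicalClosure_eq_top_of_separatesPoints _ hsep
  have hle : (Algebra.adjoin ℝ (S : Set C(K, ℝ)) : Set C(K, ℝ)) ⊆ {f | p f = 0} := by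
    have : Subalgebra.toSubmodule (Algebra.adjoin ℝ (S : Set C(K, ℝ))) ≤
        LinearMap.ker p.toLinearMap := by
      rw [Algebra.adjoin_eq_span, Submonoid.closure_eq, Submodule.span_le]
      rintro _ ⟨a, rfl⟩
      exact hexp a
    exact this
  have hcl := closure_minimal hle (isClosed_eq p.continuous continuous_const)
  ext f
  refine hcl ?_
  rw [← Subalgebra.topologicalClosure_coe, hdense]
  trivial

end Density

/-- The pre-activation of neuron `j` in hidden layer `i`. -/
def preactivation {L : ℕ} {w : Fin (L + 1) → ℕ} (τ : Fin L → C(ℝ, ℝ)) (α : ParamSpace w)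
    (x : EuclideanSpace ℝ (Fin (w 0))) (i : Fin L) (j : Fin (w i.succ)) : ℝ :=
  (α.weight i *ᵥ layerOutput τ α x i.castSucc + α.bias i) j

theorem layerOutput_zero {L : ℕ} {w : Fin (L + 1) → ℕ} (τ : Fin L → C(ℝ, ℝ)) (α : ParamSpace w)
    (x : EuclideanSpace ℝ (Fin (w 0))) (j : Fin (w 0)) : layerOutput τ α x 0 j = x j := rfl

theorem layerOutput_succ {L : ℕ} {w : Fin (L + 1) → ℕ} (τ : Fin L → C(ℝ, ℝ)) (α : ParamSpace w)
    (x : EuclideanSpace ℝ (Fin (w 0))) (i : Fin L) (j : Fin (w i.succ)) :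
    layerOutput τ α x i.succ j = τ i (preactivation τ α x i j) := rfl

theorem preactivation_eq {L : ℕ} {w : Fin (L + 1) → ℕ} (τ : Fin L → C(ℝ, ℝ)) (α : ParamSpace w)
    (x : EuclideanSpace ℝ (Fin (w 0))) (i : Fin L) (j : Fin (w i.succ)) :
    preactivation τ α x i j = ∑ k, α (Sum.inl ⟨i, j, Sum.inl k⟩) * layerOutput τ α x i.castSucc k +
      α (Sum.inl ⟨i, j, Sum.inr ()⟩) := rfl

theorem network_eq {L : ℕ} {w : Fin (L + 1) → ℕ} (τ : Fin L → C(ℝ, ℝ)) (α : ParamSpace w)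
    (x : EuclideanSpace ℝ (Fin (w 0))) :
    network τ α x = ∑ k, α (Sum.inr (Sum.inl k)) * layerOutput τ α x (Fin.last L) k +
      α (Sum.inr (Sum.inr ())) := rfl

section Continuity

variable {L : ℕ} {w : Fin (L + 1) → ℕ} (τ : Fin L → C(ℝ, ℝ))

theorem continuous_layerOutput_uncurry (i : Fin (L + 1)) (j : Fin (w i)) :
    Continuous fun q : ParamSpace w × EuclideanSpace ℝ (Fin (w 0)) =>
      layerOutput τ q.1 q.2 i j := by
  induction i using Fin.induction with
  | zero => simp only [layerOutput_zero]; fun_prop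
  | succ i ih =>
    simp only [layerOutput_succ, preactivation_eq]
    fun_prop

theorem continuous_preactivation_uncurry (i : Fin L) (j : Fin (w i.succ)) :
    Continuous fun q : ParamSpace w × EuclideanSpace ℝ (Fin (w 0)) =>
      preactivation τ q.1 q.2 i j := by
  have := continuous_layerOutput_uncurry (w := w) τ i.castSucc
  simp only [preactivation_eq]
  fun_prop

theorem continuous_network_param (x : EuclideanSpace ℝ (Fin (w 0))) :
    Continuous fun α : ParamSpace w => network τ α x := by
  have h := fun j => (continuous_layerOutput_uncurry (w := w) τ (Fin.last L) j).comp
    (Continuous.prodMk_left x)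
  simp only [Function.comp_def] at h
  simp only [network_eq]
  fun_prop

end Continuity

section AffineRegime

variable {L : ℕ} {w : Fin (L + 1) → ℕ}

/-- The affine activation functions `s ↦ β s + γ`. -/
def affineAct (β γ : Fin L → ℝ) (i : Fin L) : C(ℝ, ℝ) :=
  ⟨fun s => β i * s + γ i, by fun_prop⟩

@[simp] theorem affineAct_apply (β γ : Fin L → ℝ) (i : Fin L) (s : ℝ) :
    affineAct β γ i s = β i * s + γ i := rfl

/-- `τ` and `τ'` give the same network at `x` if they agree on all pre-activations. -/
theorem layerOutput_congr (τ τ' : Fin L → C(ℝ, ℝ)) (α : ParamSpace w)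
    (x : EuclideanSpace ℝ (Fin (w 0)))
    (h : ∀ i j, τ i (preactivation τ α x i j) = τ' i (preactivation τ α x i j)) (i : Fin (L + 1)) :
    layerOutput τ α x i = layerOutput τ' α x i := by
  induction i using Fin.induction with
  | zero => rfl
  | succ i ih =>
    ext j
    rw [layerOutput_succ, h, layerOutput_succ, preactivation_eq, preactivation_eq, ih]

theorem network_congr (τ τ' : Fin L → C(ℝ, ℝ)) (α : ParamSpace w)
    (x : EuclideanSpace ℝ (Fin (w 0)))
    (h : ∀ i j, τ i (preactivation τ α x i j) = τ' i (preactivation τ α x i j)) :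
    network τ α x = network τ' α x := by
  rw [network_eq, network_eq, layerOutput_congr τ τ' α x h]

theorem exists_layerOutput_affineAct (β γ : Fin L → ℝ) (α : ParamSpace w) (i : Fin (L + 1))
    (j : Fin (w i)) : ∃ (a : EuclideanSpace ℝ (Fin (w 0))) (c : ℝ),
      ∀ x, layerOutput (affineAct β γ) α x i j = inner ℝ a x + c := by
  induction i using Fin.induction with
  | zero =>
    exact ⟨EuclideanSpace.single j 1, 0, fun x => by
      simp [layerOutput_zero, EuclideanSpace.inner_single_left]⟩
  | succ i ih =>
    choose a c h using ih
    refine ⟨∑ k, (β i * α (Sum.inl ⟨i, j, Sum.inl k⟩)) • a k,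
      ∑ k, β i * α (Sum.inl ⟨i, j, Sum.inl k⟩) * c k +
        (β i * α (Sum.inl ⟨i, j, Sum.inr ()⟩) + γ i), fun x => ?_⟩
    simp only [layerOutput_succ, preactivation_eq, affineAct_apply, h, sum_inner,
      real_inner_smul_left, mul_add, Finset.sum_add_distrib, Finset.mul_sum, mul_assoc]
    ring

theorem exists_network_affineAct (β γ : Fin L → ℝ) (α : ParamSpace w) :
    ∃ (a : EuclideanSpace ℝ (Fin (w 0))) (c : ℝ),
      ∀ x, network (affineAct β γ) α x = inner ℝ a x + c := by
  choose a c h using exists_layerOutput_affineAct β γ α (Fin.last L)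
  refine ⟨∑ k, α (Sum.inr (Sum.inl k)) • a k,
    ∑ k, α (Sum.inr (Sum.inl k)) * c k + α (Sum.inr (Sum.inr ())), fun x => ?_⟩
  simp only [network_eq, h, sum_inner, real_inner_smul_left, mul_add, Finset.sum_add_distrib]
  ring

/-- All pre-activations on `K` lie in the intervals `(l i, u i)`. -/
def InRegime (τ : Fin L → C(ℝ, ℝ)) (K : Set (EuclideanSpace ℝ (Fin (w 0)))) (l u : Fin L → ℝ)
    (α : ParamSpace w) : Prop :=
  ∀ x ∈ K, ∀ i j, preactivation τ α x i j ∈ Set.Ioo (l i) (u i)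

theorem eventually_inRegime {τ : Fin L → C(ℝ, ℝ)} {K : Set (EuclideanSpace ℝ (Fin (w 0)))}
    (hK : IsCompact K) {l u : Fin L → ℝ} {α : ParamSpace w} (h : InRegime τ K l u α) :
    ∀ᶠ α' in 𝓝 α, InRegime τ K l u α' := by
  refine hK.eventually_forall_of_forall_eventually fun x hx => ?_
  refine eventually_all.2 fun i => eventually_all.2 fun j => ?_
  exact (continuous_preactivation_uncurry τ i j).continuousAt.eventually_mem
    (isOpen_Ioo.mem_nhds (h x hx i j))

theorem InRegime.network_eq {τ : Fin L → C(ℝ, ℝ)} {K : Set (EuclideanSpace ℝ (Fin (w 0)))}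
    {l u : Fin L → ℝ} {α : ParamSpace w} (h : InRegime τ K l u α) {β γ : Fin L → ℝ}
    (hτ : ∀ i, ∀ s ∈ Set.Ioo (l i) (u i), τ i s = β i * s + γ i)
    {x : EuclideanSpace ℝ (Fin (w 0))} (hx : x ∈ K) :
    network τ α x = network (affineAct β γ) α x :=
  network_congr _ _ _ _ fun i j => hτ i _ (h x hx i j)

end AffineRegime

section Perturbation

variable {L : ℕ} {w : Fin (L + 2) → ℕ}

/-- Change of the parameters that adds `δ` to the first row of the first weight matrix and `e` to
the output bias. -/
def firstRowShift (w : Fin (L + 2) → ℕ) (δ : EuclideanSpace ℝ (Fin (w 0))) (e : ℝ) :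
    ParamSpace w :=
  WithLp.toLp 2 fun
    | Sum.inl ⟨i, j, Sum.inl k⟩ =>
      if (i : ℕ) = 0 ∧ (j : ℕ) = 0 then (if h : (k : ℕ) < w 0 then δ ⟨k, h⟩ else 0) else 0
    | Sum.inl ⟨_, _, Sum.inr _⟩ => 0
    | Sum.inr (Sum.inl _) => 0
    | Sum.inr (Sum.inr _) => e

theorem continuous_firstRowShift :
    Continuous fun q : EuclideanSpace ℝ (Fin (w 0)) × ℝ => firstRowShift w q.1 q.2 := by
  refine (PiLp.continuous_toLp 2 _).comp (continuous_pi fun t => ?_)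
  rcases t with ⟨i, j, k | k⟩ | k | k
  · dsimp only
    split_ifs <;> fun_prop
  · exact continuous_const
  · exact continuous_const
  · exact continuous_snd

theorem firstRowShift_zero : firstRowShift w 0 0 = 0 := by
  ext t
  rcases t with ⟨i, j, k | k⟩ | k | k <;> simp [firstRowShift]

theorem exists_layerOutput_add_firstRowShift (β γ : Fin (L + 1) → ℝ) (α : ParamSpace w)
    (i : Fin (L + 1)) (j : Fin (w i.succ)) : ∃ v : ℝ, ∀ δ e x,
      layerOutput (affineAct β γ) (α + firstRowShift w δ e) x i.succ j =
        layerOutput (affineAct β γ) α x i.succ j + v * inner ℝ δ x := by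
  induction i using Fin.induction with
  | zero =>
    refine ⟨if (j : ℕ) = 0 then β 0 else 0, fun δ e x => ?_⟩
    have h : inner ℝ δ x = ∑ k : Fin (w 0), δ k * x k := by
      simp [PiLp.inner_apply, mul_comm]
    have h0 : ∀ α' : ParamSpace w, layerOutput (affineAct β γ) α' x (Fin.castSucc 0) =
      fun k => x k := fun _ => rfl
    have h1 : ∀ k : Fin (w 0), firstRowShift w δ e (Sum.inl ⟨0, j, Sum.inl k⟩) =
        (if (j : ℕ) = 0 then 1 else 0) * δ k := fun k => by simp [firstRowShift]
    have h2 : firstRowShift w δ e (Sum.inl ⟨0, j, Sum.inr ()⟩) = 0 := rfl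
    have h3 : ∑ k : Fin (w (Fin.castSucc 0)),
        firstRowShift w δ e (Sum.inl ⟨0, j, Sum.inl k⟩) * x k =
          (if (j : ℕ) = 0 then 1 else 0) * inner ℝ δ x := by
      rw [h, Finset.mul_sum]
      exact Finset.sum_congr rfl fun k _ => by rw [h1 k, mul_assoc]
    simp only [layerOutput_succ, preactivation_eq, affineAct_apply, h0, PiLp.add_apply, add_mul,
      Finset.sum_add_distrib, h2, h3]
    split_ifs <;> ring
  | succ i ih =>
    choose v hv using ih
    refine ⟨β i.succ * ∑ k, α (Sum.inl ⟨i.succ, j, Sum.inl k⟩) * v k, fun δ e x => ?_⟩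
    simp only [layerOutput_succ (i := i.succ), preactivation_eq, affineAct_apply, PiLp.add_apply]
    have h1 : ∀ t, firstRowShift w δ e (Sum.inl ⟨i.succ, j, t⟩) = 0 := by
      rintro (t | t) <;> simp [firstRowShift]
    have h2 : ∀ k, layerOutput (affineAct β γ) (α + firstRowShift w δ e) x i.succ.castSucc k =
      layerOutput (affineAct β γ) α x i.succ.castSucc k + v k * inner ℝ δ x := fun k => hv k δ e x
    simp only [h1, h2, add_zero, mul_add, Finset.sum_add_distrib, Finset.sum_mul, Finset.mul_sum,
      mul_assoc]
    ring

theorem exists_network_add_firstRowShift (β γ : Fin (L + 1) → ℝ) (α : ParamSpace w) :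
    ∃ v : ℝ, ∀ δ e x, network (affineAct β γ) (α + firstRowShift w δ e) x =
        network (affineAct β γ) α x + v * inner ℝ δ x + e := by
  choose v hv using exists_layerOutput_add_firstRowShift β γ α (Fin.last L)
  refine ⟨∑ k, α (Sum.inr (Sum.inl k)) * v k, fun δ e x => ?_⟩
  have h2 : ∀ k, layerOutput (affineAct β γ) (α + firstRowShift w δ e) x (Fin.last (L + 1)) k =
      layerOutput (affineAct β γ) α x (Fin.last (L + 1)) k + v k * inner ℝ δ x :=
    fun k => hv k δ e x
  have h3 : ∀ k, firstRowShift w δ e (Sum.inr (Sum.inl k)) = 0 := fun _ => rfl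
  have h4 : firstRowShift w δ e (Sum.inr (Sum.inr ())) = e := rfl
  simp only [network_eq, h2, h3, h4, PiLp.add_apply, add_zero, mul_add,
    Finset.sum_add_distrib, Finset.sum_mul, mul_assoc]
  ring

/-- If the output of a network of affine activations depends nontrivially on the first row, then for
all parameters nearby one can correct the first row and the output bias to obtain a prescribed
affine function. -/
theorem exists_tendsto_firstRowShift (hd : 1 ≤ w 0) (β γ : Fin (L + 1) → ℝ) (α₀ : ParamSpace w)
    (a : EuclideanSpace ℝ (Fin (w 0))) (c : ℝ)
    (h₀ : ∀ x, network (affineAct β γ) α₀ x = inner ℝ a x + c)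
    (hne : ∃ δ x, network (affineAct β γ) (α₀ + firstRowShift w δ 0) x ≠
      network (affineAct β γ) α₀ x) :
    ∃ (δ : ParamSpace w → EuclideanSpace ℝ (Fin (w 0))) (e : ParamSpace w → ℝ),
      Tendsto (fun α => α + firstRowShift w (δ α) (e α)) (𝓝 α₀) (𝓝 α₀) ∧
      ∀ᶠ α in 𝓝 α₀, ∀ x, network (affineAct β γ) (α + firstRowShift w (δ α) (e α)) x =
        inner ℝ a x + c := by
  choose v hv using exists_network_add_firstRowShift (w := w) β γ
  choose A C hAC using exists_network_affineAct (w := w) β γ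
  have hC : ∀ α, C α = network (affineAct β γ) α 0 := fun α => by simp [hAC]
  have hA : ∀ α k, A α k = network (affineAct β γ) α (EuclideanSpace.single k 1) -
      network (affineAct β γ) α 0 := fun α k => by
    simp [hAC, EuclideanSpace.inner_single_right]
  have hCc : Continuous C := by
    rw [funext hC]
    exact continuous_network_param _ _
  have hAc : Continuous A := by
    refine (PiLp.continuous_toLp 2 _).comp (continuous_pi fun k => ?_ :
      Continuous fun α => (A α).ofLp)
    simp only [hA]
    exact (continuous_network_param _ _).sub (continuous_network_param _ _)
  have hvc : Continuous v := by
    have : ∀ α, v α = network (affineAct β γ)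
        (α + firstRowShift w (EuclideanSpace.single ⟨0, hd⟩ 1) 0) (EuclideanSpace.single ⟨0, hd⟩ 1)
        - network (affineAct β γ) α (EuclideanSpace.single ⟨0, hd⟩ 1) := fun α => by
      rw [hv]
      simp
    rw [funext this]
    exact ((continuous_network_param _ _).comp (continuous_id.add continuous_const)).sub
      (continuous_network_param _ _)
  have hv0 : v α₀ ≠ 0 := by
    rintro h
    obtain ⟨δ, x, hx⟩ := hne
    exact hx (by rw [hv, h]; ring)
  have hC0 : C α₀ = c := by simpa [hC] using h₀ 0
  have hA0 : A α₀ = a := by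
    ext k
    rw [hA, h₀, h₀]
    simp [EuclideanSpace.inner_single_right]
  refine ⟨fun α => (v α)⁻¹ • (a - A α), fun α => c - C α, ?_, ?_⟩
  · have h1 : Tendsto (fun α => ((v α)⁻¹ • (a - A α), c - C α)) (𝓝 α₀) (𝓝 (0, 0)) := by
      refine Tendsto.prodMk_nhds ?_ ?_
      · have := (hvc.continuousAt.inv₀ hv0).smul (continuousAt_const (y := a).sub hAc.continuousAt)
        simpa [ContinuousAt, hA0, Pi.smul_def', Pi.sub_def] using this
      · have := continuousAt_const (y := c).sub (hCc.continuousAt (x := α₀))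
        simpa [ContinuousAt, hC0, Pi.sub_def] using this
    have h2 := tendsto_id.add ((continuous_firstRowShift (w := w)).continuousAt.tendsto.comp h1)
    simpa [firstRowShift_zero] using h2
  · filter_upwards [hvc.continuousAt.eventually_ne hv0] with α hα x
    rw [hv, hAC, real_inner_smul_left, inner_sub_left, mul_inv_cancel_left₀ hα]
    ring

end Perturbation

section Channels

variable {L : ℕ} {w : Fin (L + 2) → ℕ}

/-- Parameters for which the pre-activation of neuron `j` in layer `i` is `μ i j + e i j * ⟪a j, x⟫`
as long as the neurons feeding into it operate where their activation is `s ↦ β s + γ`. -/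
noncomputable def channelParam (w : Fin (L + 2) → ℕ) (β γ : Fin (L + 1) → ℝ)
    (a : ℕ → EuclideanSpace ℝ (Fin (w 0))) (e μ : Fin (L + 1) → ℕ → ℝ) (o : ℕ → ℝ) (c : ℝ) :
    ParamSpace w :=
  WithLp.toLp 2 fun
    | Sum.inl ⟨i, j, Sum.inl k⟩ =>
      Fin.cases (motive := fun _ => ℝ) (if h : (k : ℕ) < w 0 then e 0 j * a j ⟨k, h⟩ else 0)
        (fun i => if (k : ℕ) = j then e i.succ j / (e i.castSucc j * β i.castSucc) else 0) i
    | Sum.inl ⟨i, j, Sum.inr _⟩ =>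
      Fin.cases (motive := fun _ => ℝ) (μ 0 j)
        (fun i => μ i.succ j - e i.succ j / (e i.castSucc j * β i.castSucc) *
          (β i.castSucc * μ i.castSucc j + γ i.castSucc)) i
    | Sum.inr (Sum.inl k) => o k
    | Sum.inr (Sum.inr _) => c

variable {β γ : Fin (L + 1) → ℝ} {a : ℕ → EuclideanSpace ℝ (Fin (w 0))}
  {e μ : Fin (L + 1) → ℕ → ℝ} {o : ℕ → ℝ} {c : ℝ}

theorem preactivation_channelParam (hw : ∀ i : Fin (L + 1), 2 ≤ w i.succ) (hβ : ∀ i, β i ≠ 0)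
    (he : ∀ i : Fin L, ∀ j < 2, e i.castSucc j ≠ 0) (he2 : ∀ i, ∀ j ≥ 2, e i j = 0)
    (τ : Fin (L + 1) → C(ℝ, ℝ)) (x : EuclideanSpace ℝ (Fin (w 0)))
    (hτ : ∀ i : Fin L, ∀ j < 2, τ i.castSucc (μ i.castSucc j + e i.castSucc j * inner ℝ (a j) x) =
      β i.castSucc * (μ i.castSucc j + e i.castSucc j * inner ℝ (a j) x) + γ i.castSucc)
    (i : Fin (L + 1)) (j : Fin (w i.succ)) :
    preactivation τ (channelParam w β γ a e μ o c) x i j = μ i j + e i j * inner ℝ (a j) x := by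
  induction i using Fin.induction with
  | zero =>
    have h1 : ∀ k : Fin (w 0), channelParam w β γ a e μ o c (Sum.inl ⟨0, j, Sum.inl k⟩) =
        e 0 j * a j k := fun k => by simp [channelParam]
    have h2 : channelParam w β γ a e μ o c (Sum.inl ⟨0, j, Sum.inr ()⟩) = μ 0 j := rfl
    have h3 : ∑ k : Fin (w (Fin.castSucc 0)), channelParam w β γ a e μ o c
        (Sum.inl ⟨0, j, Sum.inl k⟩) * layerOutput τ (channelParam w β γ a e μ o c) x
          (Fin.castSucc 0) k = e 0 j * inner ℝ (a j) x := by
      rw [PiLp.inner_apply, Finset.mul_sum]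
      refine Finset.sum_congr rfl fun k _ => ?_
      refine (congrArg₂ (· * ·) (h1 k) (layerOutput_zero τ _ x k)).trans ?_
      simp only [RCLike.inner_apply, conj_trivial]
      ring
    rw [preactivation_eq, h2, h3, add_comm]
  | succ i ih =>
    have h1 : ∀ k : Fin (w i.succ.castSucc), channelParam w β γ a e μ o c
        (Sum.inl ⟨i.succ, j, Sum.inl k⟩) =
          if (k : ℕ) = j then e i.succ j / (e i.castSucc j * β i.castSucc) else 0 := fun k => rfl
    have h2 : channelParam w β γ a e μ o c (Sum.inl ⟨i.succ, j, Sum.inr ()⟩) =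
      μ i.succ j - e i.succ j / (e i.castSucc j * β i.castSucc) *
          (β i.castSucc * μ i.castSucc j + γ i.castSucc) := rfl
    rw [preactivation_eq, h2]
    simp only [h1]
    by_cases hj : (j : ℕ) < 2
    · have hjw : (j : ℕ) < w i.succ.castSucc := hj.trans_le (hw i.castSucc)
      rw [Finset.sum_eq_single ⟨j, hjw⟩ (fun k _ hk => by
        rw [if_neg fun h => hk (Fin.ext h), zero_mul]) (by simp), if_pos rfl]
      have h3 : layerOutput τ (channelParam w β γ a e μ o c) x i.succ.castSucc ⟨j, hjw⟩ =
          β i.castSucc * (μ i.castSucc j + e i.castSucc j * inner ℝ (a j) x) + γ i.castSucc :=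
        (congrArg (τ i.castSucc) (ih ⟨j, hjw⟩)).trans (hτ i j hj)
      rw [h3]
      have := he i j hj
      have := hβ i.castSucc
      field_simp
      ring
    · simp [he2 _ _ (not_lt.1 hj)]

/-- The channel network with `⟪a₀, x⟫` in the first channel, `⟪a₁, x⟫` in the second channel,
scaled by `ε` except for the second channel in the last hidden layer, and output
`⟪a₀, x⟫ + c + s * τ (b + ⟪a₁, x⟫)`. -/
noncomputable def twoChannelParam (w : Fin (L + 2) → ℕ) (β γ m : Fin (L + 1) → ℝ) (ε : ℝ)
    (a₀ a₁ : EuclideanSpace ℝ (Fin (w 0))) (b s c : ℝ) : ParamSpace w :=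
  channelParam w β γ (fun j => if j = 0 then a₀ else a₁)
    (fun i j => if j < 2 then (if j = 1 ∧ i = Fin.last L then 1 else ε) else 0)
    (fun i j => if j = 1 ∧ i = Fin.last L then b else m i)
    (fun j => if j = 0 then (ε * β (Fin.last L))⁻¹ else if j = 1 then s else 0)
    (c - (ε * β (Fin.last L))⁻¹ * (β (Fin.last L) * m (Fin.last L) + γ (Fin.last L)))

variable {m : Fin (L + 1) → ℝ} {ε : ℝ} {a₀ a₁ : EuclideanSpace ℝ (Fin (w 0))} {b s c : ℝ}

theorem preactivation_twoChannelParam (hw : ∀ i : Fin (L + 1), 2 ≤ w i.succ) (hβ : ∀ i, β i ≠ 0)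
    (hε : ε ≠ 0) (τ : Fin (L + 1) → C(ℝ, ℝ)) (x : EuclideanSpace ℝ (Fin (w 0)))
    (hτ₀ : ∀ i, τ i (m i + ε * inner ℝ a₀ x) = β i * (m i + ε * inner ℝ a₀ x) + γ i)
    (hτ₁ : ∀ i, τ i (m i + ε * inner ℝ a₁ x) = β i * (m i + ε * inner ℝ a₁ x) + γ i)
    (i : Fin (L + 1)) (j : Fin (w i.succ)) :
    preactivation τ (twoChannelParam w β γ m ε a₀ a₁ b s c) x i j =
      if (j : ℕ) = 0 then m i + ε * inner ℝ a₀ x else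
      if (j : ℕ) = 1 then
        (if i = Fin.last L then b + inner ℝ a₁ x else m i + ε * inner ℝ a₁ x) else m i := by
  have hlast : ∀ i : Fin L, i.castSucc ≠ Fin.last L := fun i => (Fin.castSucc_lt_last i).ne
  rw [twoChannelParam, preactivation_channelParam hw hβ]
  · rcases lt_trichotomy (j : ℕ) 1 with h | h | h
    · simp [Nat.lt_one_iff.1 h]
    · simp only [h]
      by_cases hi : i = Fin.last L <;> simp [hi]
    · have h1 : (j : ℕ) ≠ 0 := by omega
      have h2 : (j : ℕ) ≠ 1 := by omega
      have h3 : ¬ (j : ℕ) < 2 := by omega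
      simp [h1, h2, h3]
  · intro i j hj
    simp [hj, hlast, hε]
  · intro i j hj
    simp [not_lt.2 hj]
  · intro i j hj
    interval_cases j <;> simp [hlast, hτ₀, hτ₁]

theorem network_twoChannelParam (hw : ∀ i : Fin (L + 1), 2 ≤ w i.succ) (hβ : ∀ i, β i ≠ 0)
    (hε : ε ≠ 0) (τ : Fin (L + 1) → C(ℝ, ℝ)) (x : EuclideanSpace ℝ (Fin (w 0)))
    (hτ₀ : ∀ i, τ i (m i + ε * inner ℝ a₀ x) = β i * (m i + ε * inner ℝ a₀ x) + γ i)
    (hτ₁ : ∀ i, τ i (m i + ε * inner ℝ a₁ x) = β i * (m i + ε * inner ℝ a₁ x) + γ i) :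
    network τ (twoChannelParam w β γ m ε a₀ a₁ b s c) x =
      inner ℝ a₀ x + c + s * τ (Fin.last L) (b + inner ℝ a₁ x) := by
  have hpre := preactivation_twoChannelParam (b := b) (s := s) (c := c) hw hβ hε τ x hτ₀ hτ₁
    (Fin.last L)
  set α := twoChannelParam w β γ m ε a₀ a₁ b s c with hα
  have hout : ∀ k : Fin (w (Fin.last (L + 1))), α (Sum.inr (Sum.inl k)) =
    if (k : ℕ) = 0 then (ε * β (Fin.last L))⁻¹ else if (k : ℕ) = 1 then s else 0 := fun k => rfl
  have hbias : α (Sum.inr (Sum.inr ())) = c - (ε * β (Fin.last L))⁻¹ *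
    (β (Fin.last L) * m (Fin.last L) + γ (Fin.last L)) := rfl
  have h2 : 2 ≤ w (Fin.last (L + 1)) := hw (Fin.last L)
  have hlay : ∀ k : Fin (w (Fin.last (L + 1))), layerOutput τ α x (Fin.last (L + 1)) k =
    τ (Fin.last L) (preactivation τ α x (Fin.last L) k) := fun k => rfl
  let k₀ : Fin (w (Fin.last (L + 1))) := ⟨0, by omega⟩
  let k₁ : Fin (w (Fin.last (L + 1))) := ⟨1, by omega⟩
  have h01 : k₀ ≠ k₁ := by simp [k₀, k₁]
  rw [network_eq, hbias, Finset.sum_eq_add k₀ k₁ h01 (fun k _ hk => by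
    have hk0 : (k : ℕ) ≠ 0 := fun h => hk.1 (Fin.ext h)
    have hk1 : (k : ℕ) ≠ 1 := fun h => hk.2 (Fin.ext h)
    rw [hout, if_neg hk0, if_neg hk1, zero_mul]) (by simp) (by simp)]
  simp only [hlay, hout]
  rw [hpre k₀, hpre k₁]
  simp only [k₀, k₁, if_true, one_ne_zero, if_false]
  rw [hτ₀]
  have := hβ (Fin.last L)
  field_simp
  ring

/-- Shifting the first row of the first layer changes the vector carried by the first channel. -/
theorem twoChannelParam_add_firstRowShift (hε : ε ≠ 0) (δ : EuclideanSpace ℝ (Fin (w 0))) :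
    twoChannelParam w β γ m ε a₀ a₁ b s c + firstRowShift w δ 0 =
      twoChannelParam w β γ m ε (a₀ + ε⁻¹ • δ) a₁ b s c := by
  ext t
  rcases t with ⟨i, j, k | k⟩ | k | k
  · induction i using Fin.cases with
    | zero =>
      by_cases hj : (j : ℕ) = 0
      · have hk : (k : ℕ) < w 0 := k.2
        simp [twoChannelParam, channelParam, firstRowShift, hj, hk, mul_add, hε]
      · simp [twoChannelParam, channelParam, firstRowShift, hj]
    | succ i => simp [twoChannelParam, channelParam, firstRowShift]
  · simp [twoChannelParam, channelParam, firstRowShift]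
  · simp [twoChannelParam, channelParam, firstRowShift]
  · simp [twoChannelParam, channelParam, firstRowShift]

end Channels

/-- If, locally, every point can be moved into `E` by changing only coordinates in `S`, then `E` has
dimension at least the number of the other coordinates. -/
theorem le_dimH_of_eventually_exists {ι : Type*} [Fintype ι] [DecidableEq ι] (S : Finset ι)
    {E : Set (EuclideanSpace ℝ ι)} {α₀ : EuclideanSpace ℝ ι}
    (h : ∀ᶠ α in 𝓝 α₀, ∃ α' ∈ E, ∀ t ∉ S, α' t = α t) :
    ((Fintype.card ι - S.card : ℕ) : ℝ≥0∞) ≤ dimH E := by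
  let π : EuclideanSpace ℝ ι →L[ℝ] ({t // t ∉ S} → ℝ) :=
    ContinuousLinearMap.pi fun t => EuclideanSpace.proj t.1
  have hsurj : Function.Surjective π := fun f =>
    ⟨WithLp.toLp 2 fun t => if ht : t ∉ S then f ⟨t, ht⟩ else 0, by
      ext t
      simp [π, t.2]⟩
  have hmem : π '' E ∈ 𝓝 (π α₀) := by
    refine mem_of_superset ((π.isOpenMap hsurj).image_mem_nhds h) ?_
    rintro _ ⟨α, ⟨α', hE, hα'⟩, rfl⟩
    exact ⟨α', hE, funext fun t => hα' t t.2⟩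
  have hdim := Real.dimH_of_mem_nhds hmem
  rw [Module.finrank_fintype_fun_eq_card, Fintype.card_subtype_compl, Fintype.card_coe] at hdim
  rw [← hdim]
  exact π.lipschitz.dimH_image_le E

/-- The indices of the first row of the first weight matrix and of the output bias. -/
def firstRowIndex {L : ℕ} (w : Fin (L + 2) → ℕ) (h : 0 < w (Fin.succ 0)) :
    Fin (w 0) ⊕ Unit → ParamIndex w
  | Sum.inl k => Sum.inl ⟨0, ⟨0, h⟩, Sum.inl k⟩
  | Sum.inr _ => Sum.inr (Sum.inr ())

theorem firstRowShift_apply_of_notMem {L : ℕ} {w : Fin (L + 2) → ℕ} (h : 0 < w (Fin.succ 0))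
    (δ : EuclideanSpace ℝ (Fin (w 0))) (e : ℝ) {t : ParamIndex w}
    (ht : t ∉ Finset.univ.image (firstRowIndex w h)) : firstRowShift w δ e t = 0 := by
  rcases t with ⟨i, j, k | k⟩ | k | k
  · refine if_neg fun hij => ht (Finset.mem_image.2 ?_)
    obtain rfl : i = 0 := Fin.ext hij.1
    obtain rfl : j = ⟨0, h⟩ := Fin.ext hij.2
    exact ⟨Sum.inl k, Finset.mem_univ _, rfl⟩
  · rfl
  · rfl
  · exact absurd (Finset.mem_image.2 ⟨Sum.inr (), Finset.mem_univ _, rfl⟩) ht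

/-- A common scale at which finitely many linear forms are
small on a compact set. -/
theorem exists_pos_mul_inner_lt {V : Type*} [NormedAddCommGroup V] [InnerProductSpace ℝ V]
    {K : Set V} (hK : IsCompact K) {ι : Type*} [Finite ι] {r : ι → ℝ} (hr : ∀ i, 0 < r i)
    (a₀ a₁ : V) :
    ∃ ε > 0, ∀ x ∈ K, ∀ i, |ε * inner ℝ a₀ x| < r i ∧ |ε * inner ℝ a₁ x| < r i := by
  have h : ∀ᶠ ε in 𝓝 (0 : ℝ), ∀ x ∈ K, ∀ i,
      |ε * inner ℝ a₀ x| < r i ∧ |ε * inner ℝ a₁ x| < r i := by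
    refine hK.eventually_forall_of_forall_eventually fun x hx => eventually_all.2 fun i =>
      Eventually.and ?_ ?_
    · have hc : Continuous fun q : ℝ × V => |q.1 * inner ℝ a₀ q.2| := by fun_prop
      exact hc.continuousAt.eventually_lt continuousAt_const (by simpa using hr i)
    · have hc : Continuous fun q : ℝ × V => |q.1 * inner ℝ a₁ q.2| := by fun_prop
      exact hc.continuousAt.eventually_lt continuousAt_const (by simpa using hr i)
  obtain ⟨ε, hε, hpos⟩ := ((h.filter_mono nhdsWithin_le_nhds).and
    (self_mem_nhdsWithin (a := (0 : ℝ)) (s := Set.Ioi 0))).exists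
  exact ⟨ε, hpos, hε⟩

theorem HasGateauxDerivAt.nonneg {E : Type*} [AddCommGroup E] [Module ℝ E] [TopologicalSpace E]
    {f : E → ℝ} {f' : E →L[ℝ] ℝ} {v : E} (hf : HasGateauxDerivAt f f' v) {h : E}
    (hmin : ∀ s : ℝ, f v ≤ f (v + s • h)) : 0 ≤ f' h := by
  refine ge_of_tendsto (hf h) ?_
  filter_upwards [self_mem_nhdsWithin] with s hs
  exact div_nonneg (sub_nonneg.2 (hmin s)) (le_of_lt hs)

section Loss

variable {L : ℕ} {w : Fin (L + 2) → ℕ} {K : Set (EuclideanSpace ℝ (Fin (w 0)))}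
  {σ : Fin (L + 1) → C(ℝ, ℝ)} {l u β γ : Fin (L + 1) → ℝ}

theorem add_mem_Ioo_of_abs_lt {l u t : ℝ} (h : |t| < (u - l) / 2) :
    (l + u) / 2 + t ∈ Set.Ioo l u := by
  obtain ⟨h1, h2⟩ := abs_lt.1 h
  constructor <;> linarith

/-- A differentiable loss with nonzero derivative at an affine function can be decreased below its
value there by a network. -/
theorem exists_loss_realization_lt (hK : IsCompact K) (hw : ∀ i : Fin (L + 1), 2 ≤ w i.succ)
    (hσ : ¬ ∃ P : Polynomial ℝ, ∀ s, σ (Fin.last L) s = P.eval s)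
    (hlu : ∀ i, l i < u i) (hβ : ∀ i, β i ≠ 0)
    (haff : ∀ i, ∀ s ∈ Set.Ioo (l i) (u i), σ i s = β i * s + γ i)
    (f : C(K, ℝ) → ℝ) (a : EuclideanSpace ℝ (Fin (w 0))) (c : ℝ)
    (hf : ∃ p : C(K, ℝ) →L[ℝ] ℝ, p ≠ 0 ∧ HasGateauxDerivAt f p (affineFun K a c)) :
    ∃ α : ParamSpace w, f (realization σ K α) < f (affineFun K a c) := by
  by_contra! hmin
  have : CompactSpace K := isCompact_iff_compactSpace.1 hK
  obtain ⟨p, hp0, hp⟩ := hf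
  let ridge : EuclideanSpace ℝ (Fin (w 0)) → ℝ → C(K, ℝ) := fun a b =>
    ⟨fun x => σ (Fin.last L) (b + inner ℝ a (x : EuclideanSpace ℝ (Fin (w 0)))), by fun_prop⟩
  have hle : ∀ a₁ b (s : ℝ), f (affineFun K a c) ≤ f (affineFun K a c + s • ridge a₁ b) := by
    intro a₁ b s
    obtain ⟨ε, hε, hεK⟩ := exists_pos_mul_inner_lt hK
      (fun i => half_pos (sub_pos.2 (hlu i))) a a₁
    have heq : realization σ K (twoChannelParam w β γ (fun i => (l i + u i) / 2) ε a a₁ b s c) =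
        affineFun K a c + s • ridge a₁ b := by
      ext x
      refine network_twoChannelParam hw hβ hε.ne' σ x (fun i => ?_) fun i => ?_
      · exact haff i _ (add_mem_Ioo_of_abs_lt (hεK x x.2 i).1)
      · exact haff i _ (add_mem_Ioo_of_abs_lt (hεK x x.2 i).2)
    exact heq ▸ hmin _
  refine hp0 (eq_zero_of_map_ridge_eq_zero K (σ (Fin.last L)) hσ p ridge (fun _ _ _ => rfl)
    fun a₁ b => le_antisymm ?_ (hp.nonneg (hle a₁ b)))
  have h := hp.nonneg (h := -ridge a₁ b) fun s => by
    simpa only [smul_neg, neg_smul] using hle a₁ b (-s)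
  rw [map_neg] at h
  linarith

/-- The parameters near a network in the affine regime that realize a given affine function
form a set of codimension at most `w 0 + 1`. -/
theorem exists_le_dimH_realization_eq (hd : 1 ≤ w 0) (hK : IsCompact K)
    (hw : ∀ i : Fin (L + 1), 2 ≤ w i.succ) (hlu : ∀ i, l i < u i) (hβ : ∀ i, β i ≠ 0)
    (haff : ∀ i, ∀ s ∈ Set.Ioo (l i) (u i), σ i s = β i * s + γ i)
    (a : EuclideanSpace ℝ (Fin (w 0))) (c : ℝ) :
    ((numParams w - w 0 - 1 : ℕ) : ℝ≥0∞) ≤ dimH {α : ParamSpace w |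
      realization σ K α = affineFun K a c ∧
        ∀ᶠ α' in 𝓝 α, ∃ a' c', realization σ K α' = affineFun K a' c'} := by
  obtain ⟨ε, hε, hεK⟩ := exists_pos_mul_inner_lt hK
    (fun i => half_pos (sub_pos.2 (hlu i))) a 0
  set m : Fin (L + 1) → ℝ := fun i => (l i + u i) / 2 with hm
  let α₀ : ParamSpace w := twoChannelParam w β γ m ε a 0 (m (Fin.last L)) 0 c
  have hreg : InRegime σ K l u α₀ := by
    intro x hx i j
    have h0 : ∀ i, m i + ε * inner ℝ a x ∈ Set.Ioo (l i) (u i) := fun i =>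
      add_mem_Ioo_of_abs_lt (hεK x hx i).1
    have h1 : ∀ i, m i + ε * inner ℝ 0 x ∈ Set.Ioo (l i) (u i) := fun i =>
      add_mem_Ioo_of_abs_lt (hεK x hx i).2
    rw [preactivation_twoChannelParam hw hβ hε.ne' σ x (fun i => haff i _ (h0 i))
      (fun i => haff i _ (h1 i))]
    simp only [inner_zero_left, mul_zero, add_zero] at h1 ⊢
    split_ifs with h h' h''
    · exact h0 i
    · exact h'' ▸ h1 i
    · exact h1 i
    · exact h1 i
  have hnet : ∀ a x, network (affineAct β γ)
      (twoChannelParam w β γ m ε a 0 (m (Fin.last L)) 0 c) x = inner ℝ a x + c := by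
    intro a x
    rw [network_twoChannelParam hw hβ hε.ne' _ x (fun _ => rfl) fun _ => rfl]
    ring
  have hregular : ∀ α, InRegime σ K l u α → ∃ a' c', realization σ K α = affineFun K a' c' := by
    intro α hα
    obtain ⟨a', c', h⟩ := exists_network_affineAct (w := w) β γ α
    exact ⟨a', c', by
      ext x
      exact (hα.network_eq haff x.2).trans (h x)⟩
  have hne : ∃ δ x, network (affineAct β γ) (α₀ + firstRowShift w δ 0) x ≠
      network (affineAct β γ) α₀ x := by
    refine ⟨EuclideanSpace.single ⟨0, hd⟩ 1, EuclideanSpace.single ⟨0, hd⟩ 1, ?_⟩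
    rw [twoChannelParam_add_firstRowShift hε.ne', hnet, hnet, inner_add_left, real_inner_smul_left]
    simp [EuclideanSpace.inner_single_right, hε.ne']
  obtain ⟨δ, e, htend, hsolve⟩ := exists_tendsto_firstRowShift hd β γ α₀ a c (hnet a) hne
  have hw1 : 0 < w (Fin.succ 0) := Nat.lt_of_lt_of_le (by norm_num) (hw 0)
  have hcard : numParams w - w 0 - 1 ≤
      Fintype.card (ParamIndex w) - (Finset.univ.image (firstRowIndex w hw1)).card := by
    have h1 : Fintype.card (ParamIndex w) = numParams w := by
      rw [← finrank_paramSpace, finrank_euclideanSpace]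
    have h2 : (Finset.univ.image (firstRowIndex w hw1)).card ≤ w 0 + 1 :=
      Finset.card_image_le.trans (by simp)
    omega
  refine le_trans (by exact_mod_cast hcard) (le_dimH_of_eventually_exists
    (Finset.univ.image (firstRowIndex w hw1)) (α₀ := α₀) ?_)
  filter_upwards [hsolve, htend.eventually (eventually_inRegime hK hreg).eventually_nhds]
    with α h1 h2
  refine ⟨_, ⟨?_, h2.mono hregular⟩, fun t ht => ?_⟩
  · ext x
    exact (h2.self_of_nhds.network_eq haff x.2).trans (h1 x)
  · rw [PiLp.add_apply, firstRowShift_apply_of_notMem hw1 _ _ ht, add_zero]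

end Loss

theorem theorem3p1
    {L : ℕ} (hL : 1 ≤ L)
    (w : Fin (L + 1) → ℕ) (hd : 1 ≤ w 0)
    (K : Set (EuclideanSpace ℝ (Fin (w 0)))) (hKne : K.Nonempty) (hK : IsCompact K)
    (σ : Fin L → C(ℝ, ℝ))
    (hσpoly : ∀ i, ¬ ∃ p : Polynomial ℝ, ∀ s, σ i s = p.eval s)
    -- all hidden layers have width at least two
    (hw : ∀ i : Fin L, 2 ≤ w i.succ)
    -- every activation is affine and nonconstant on some nonempty open interval
    (hσaff : ∀ i, ∃ l u : ℝ, l < u ∧ ∃ β γ : ℝ, β ≠ 0 ∧ ∀ s ∈ Set.Ioo l u, σ i s = β * s + γ)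
    -- the target is nonaffine
    (yT : C(K, ℝ)) (hyT : ¬ ∃ a c, ∀ x, yT x = affineFun K a c x)
    -- the loss is Gâteaux differentiable with nonzero derivative away from the target
    (loss : C(K, ℝ) → C(K, ℝ) → ℝ)
    (hloss : ∀ v : C(K, ℝ), v ≠ yT →
      ∃ p : C(K, ℝ) →L[ℝ] ℝ, p ≠ 0 ∧ HasGateauxDerivAt (fun u => loss u yT) p v)
    -- an affine best approximation exists
    (hbest : ∃ a' c', ∀ a c, loss (affineFun K a' c') yT ≤ loss (affineFun K a c) yT) :
    ∃ E : Set (ParamSpace w),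
      ((numParams w - w 0 - 1 : ℕ) : ℝ≥0∞) ≤ dimH E ∧
      ∀ α ∈ E,
        IsSpuriousLocalMin (fun β : ParamSpace w => loss (realization σ K β) yT) α ∧
        IsLeast
          (Set.range fun q : EuclideanSpace ℝ (Fin (w 0)) × ℝ => loss (affineFun K q.1 q.2) yT)
          (loss (realization σ K α) yT) := by

  obtain ⟨L, rfl⟩ : ∃ L', L = L' + 1 := ⟨L - 1, by omega⟩
  choose l u hlu β γ hβ haff using hσaff
  obtain ⟨a, c, hac⟩ := hbest
  refine ⟨_, exists_le_dimH_realization_eq hd hK hw hlu hβ haff a c, ?_⟩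
  rintro α ⟨hα, hev⟩
  have hne : affineFun K a c ≠ yT := fun h => hyT ⟨a, c, fun x => by rw [h]⟩
  refine ⟨⟨?_, fun hglob => ?_⟩, ?_⟩
  · filter_upwards [hev] with α' hα'
    obtain ⟨a', c', h⟩ := hα'
    rw [hα, h]
    exact hac a' c'
  · obtain ⟨α', h⟩ := exists_loss_realization_lt hK hw (hσpoly _) hlu hβ haff
      (fun v => loss v yT) a c (hloss _ hne)
    exact absurd h (not_lt.2 (by simpa only [hα] using hglob α'))
  · rw [hα]
    exact ⟨⟨(a, c), rfl⟩, by rintro _ ⟨q, rfl⟩; exact hac q.1 q.2⟩
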